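/- Let $r\ge 1$, and let $m_{i,j}$ be a positive integer for all $1\le i<j\le r+1$; put $M=\sum_{1\le i<j\le r+1}m_{i,j}$. Let $e_1,\dots,e_{r+1}$ be the standard basis of $\mathbb{R}^{r+1}$, let $V=\{a\in\mathbb{R}^{r+1} : \sum_i a_i=0\}$, and write $a\in V$ as $a=\sum_{i=1}^r a_i(e_i-e_{r+1})$. For $a\in V$ consider the flow polytope $$P_{A_r^+,m}(a)=\Big\{(y_{i,j,k})\in\mathbb{R}^M : y_{i,j,k}\ge 0,\ \sum_{1\le i<j\le r+1}\ \sum_{1\le k\le m_{i,j}}y_{i,j,k}(e_i-e_j)=a\Big\},$$ which lies in the fibre $\varphi^{-1}(a)$ of the linear map $\varphi:\mathbb{R}^M\to V$, $\varphi(y)=\sum y_{i,j,k}(e_i-e_j)$. Its volume is taken with respect to the quotient measure $du/da$ on $\varphi^{-1}(a)$, where $du$ is Lebesgue measure on $\mathbb{R}^M$ and $da$ is the Lebesgue measure on $V$ normalized by the lattice generated by the vectors $e_i-e_j$. Let $\mathfrak{c}_{\mathrm{nice}}=\{a\in V : a_i>0,\ i=1,\dots,r\}$ be the nice chamber. Theorem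 3.1. There is exactly one polynomial $v=v(a_1,\dots,a_r)$ with real coefficients that equals the (finite) volume of $P_{A_r^+,m}(a)$ for every $a$ in the closure of $\mathfrak{c}_{\mathrm{nice}}$. It is homogeneous of degree $M-r$, and it satisfies the system of differential equations $$\Big(\prod_{j=i+1}^{r}(\partial_i-\partial_j)^{m_{i,j}}\Big)\,\partial_i^{\,m_{i,r+1}}\,v=0\qquad(i=1,\dots,r),$$ where $\partial_i=\partial/\partial a_i$; that is, $\partial_r^{m_{r,r+1}}v=0$, $(\partial_{r-1}-\partial_r)^{m_{r-1,r}}\partial_{r-1}^{m_{r-1,r+1}}v=0$, …, $(\partial_1-\partial_2)^{m_{1,2}}\cdots(\partial_1-\partial_r)^{m_{1,r}}\partial_1^{m_{1,r+1}}v=0$. -/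

import Mathlib

open MeasureTheory
open scoped ENNReal

noncomputable section

namespace FlowPolytope

/-! ### Quotient Lebesgue measure on the fibres of a linear map -/

section Quotient

set_option linter.unusedSectionVars false

variable {E V : Type*} [NormedAddCommGroup E] [NormedSpace ℝ E] [MeasurableSpace E]
  [NormedAddCommGroup V] [NormedSpace ℝ V] [MeasurableSpace V]

/-- A point of the fibre `φ⁻¹(a)` (a junk value if that fibre is empty). -/
def fiberPoint (φ : E →ₗ[ℝ] V) (a : V) : E := Function.invFun φ a

/-- `ν` is the quotient `du / da` of the measures `du` on `E` and `da` on `V` along `φ : E → V`: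
a translation invariant (Haar) measure on `ker φ` such that
`∫_E f du = ∫_V (∫_{φ⁻¹(a)} f dν) da` for all measurable `f ≥ 0`.  The affine space `φ⁻¹(a)` is
identified with `ker φ` by a translation. -/
def IsQuotientMeasure (φ : E →ₗ[ℝ] V) (du : Measure E) (da : Measure V)
    (ν : Measure (LinearMap.ker φ)) : Prop :=
  ν.IsAddHaarMeasure ∧ ∀ f : E → ℝ≥0∞, Measurable f →
    ∫⁻ u, f u ∂du = ∫⁻ a, (∫⁻ k : LinearMap.ker φ, f (fiberPoint φ a + k) ∂ν) ∂da

open Classical in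
/-- The quotient measure `du / da` on `ker φ`; see `isQuotientMeasure_quotientMeasure` and
`IsQuotientMeasure.unique` for its existence and uniqueness when `φ` is surjective. -/
def quotientMeasure (φ : E →ₗ[ℝ] V) (du : Measure E) (da : Measure V) :
    Measure (LinearMap.ker φ) :=
  if h : ∃ ν, IsQuotientMeasure φ du da ν then h.choose else 0

/-- The volume, for `du / da`, of a subset `S` of the affine space `φ⁻¹(a)`. -/
def fiberVolume (φ : E →ₗ[ℝ] V) (du : Measure E) (da : Measure V) (a : V) (S : Set E) : ℝ≥0∞ :=
  quotientMeasure φ du da {k | fiberPoint φ a + (k : E) ∈ S}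

theorem map_fiberPoint {φ : E →ₗ[ℝ] V} (hφ : Function.Surjective φ) (a : V) :
    φ (fiberPoint φ a) = a :=
  Function.rightInverse_invFun hφ a

theorem lintegral_fiber_eq [BorelSpace E] {φ : E →ₗ[ℝ] V}
    (hφ : Function.Surjective φ)
    (ν : Measure (LinearMap.ker φ)) [ν.IsAddLeftInvariant] (f : E → ℝ≥0∞) {a : V} {u : E}
    (hu : φ u = a) :
    ∫⁻ k : LinearMap.ker φ, f (fiberPoint φ a + k) ∂ν =
      ∫⁻ k : LinearMap.ker φ, f (u + k) ∂ν := by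
  have hk : fiberPoint φ a - u ∈ LinearMap.ker φ := by
    simp [LinearMap.mem_ker, map_fiberPoint hφ, hu]
  rw [← lintegral_add_left_eq_self (μ := ν) (fun k : LinearMap.ker φ => f (u + k))
    ⟨fiberPoint φ a - u, hk⟩]
  congr 1
  ext k
  congr 1
  simp only [Submodule.coe_add]
  abel

variable [BorelSpace E] [BorelSpace V] [FiniteDimensional ℝ E] [FiniteDimensional ℝ V]

theorem exists_isQuotientMeasure {φ : E →ₗ[ℝ] V} (hφ : Function.Surjective φ)
    (du : Measure E) (da : Measure V) [du.IsAddHaarMeasure] [da.IsAddHaarMeasure] :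
    ∃ ν, IsQuotientMeasure φ du da ν := by
  obtain ⟨s, hs⟩ := φ.exists_rightInverse_of_surjective (LinearMap.range_eq_top.2 hφ)
  have hs' : ∀ a, φ (s a) = a := fun a => by
    simpa using LinearMap.congr_fun hs a
  let T : (V × LinearMap.ker φ) ≃ₗ[ℝ] E :=
    { toFun := fun p => s p.1 + p.2
      map_add' := by
        intro p q
        simp only [Prod.fst_add, Prod.snd_add, map_add, Submodule.coe_add]
        abel
      map_smul' := by intro c p; simp
      invFun := fun u => (φ u, ⟨u - s (φ u), by simp [LinearMap.mem_ker, hs']⟩)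
      left_inv := by
        rintro ⟨a, k, hk⟩
        have hk0 : φ k = 0 := hk
        ext <;> simp [hs', hk0]
      right_inv := by intro u; simp }
  let ν0 : Measure (LinearMap.ker φ) := Measure.addHaar
  have hmap : (Measure.map T (da.prod ν0)).IsAddHaarMeasure :=
    T.toContinuousLinearEquiv.isAddHaarMeasure_map (da.prod ν0)
  obtain ⟨c, hc0, hct, hc⟩ :
      ∃ c : ℝ≥0∞, c ≠ 0 ∧ c ≠ ∞ ∧ du = c • Measure.map T (da.prod ν0) := by
    refine ⟨_, ?_, ?_, Measure.isAddLeftInvariant_eq_smul _ _⟩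
    · have := Measure.addHaarScalarFactor_pos_of_isAddHaarMeasure du
        (Measure.map T (da.prod ν0))
      exact_mod_cast this.ne'
    · exact ENNReal.coe_ne_top
  have hν : (c • ν0).IsAddHaarMeasure := Measure.IsAddHaarMeasure.smul ν0 hc0 hct
  refine ⟨c • ν0, hν, fun f hf => ?_⟩
  have hT : Measurable T := T.toContinuousLinearEquiv.continuous.measurable
  have h1 : ∀ a, ∫⁻ k : LinearMap.ker φ, f (fiberPoint φ a + k) ∂(c • ν0) =
      c * ∫⁻ k : LinearMap.ker φ, f (T (a, k)) ∂ν0 := by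
    intro a
    rw [lintegral_fiber_eq hφ (c • ν0) f (hs' a), lintegral_smul_measure]
    rfl
  have hfT : Measurable fun p => f (T p) := hf.comp hT
  simp_rw [h1]
  rw [lintegral_const_mul _ hfT.lintegral_prod_right', hc, lintegral_smul_measure,
    lintegral_map hf hT, lintegral_prod _ hfT.aemeasurable]
  rfl

theorem isQuotientMeasure_quotientMeasure {φ : E →ₗ[ℝ] V} (hφ : Function.Surjective φ)
    (du : Measure E) (da : Measure V) [du.IsAddHaarMeasure] [da.IsAddHaarMeasure] :
    IsQuotientMeasure φ du da (quotientMeasure φ du da) := by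
  have h := exists_isQuotientMeasure hφ du da
  rw [quotientMeasure, dif_pos h]
  exact h.choose_spec

theorem IsQuotientMeasure.unique {φ : E →ₗ[ℝ] V}
    {du : Measure E} {da : Measure V} [du.IsAddHaarMeasure]
    {ν ν' : Measure (LinearMap.ker φ)} (h : IsQuotientMeasure φ du da ν)
    (h' : IsQuotientMeasure φ du da ν') : ν = ν' := by
  have := h.1
  have := h'.1
  have hc := Measure.isAddLeftInvariant_eq_smul ν ν'
  set c : NNReal := Measure.addHaarScalarFactor ν ν' with hcdef
  let f : E → ℝ≥0∞ := (Metric.ball 0 1).indicator 1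
  have hf : Measurable f := measurable_one.indicator Metric.isOpen_ball.measurableSet
  have e := h.2 f hf
  have e' := h'.2 f hf
  rw [hc] at e
  simp_rw [lintegral_smul_measure] at e
  have hb : ∫⁻ u, f u ∂du = du (Metric.ball 0 1) := by
    simp only [f]
    exact lintegral_indicator_one Metric.isOpen_ball.measurableSet
  have e2 : ∫⁻ a, c • (∫⁻ k : LinearMap.ker φ, f (fiberPoint φ a + k) ∂ν') ∂da
      = c * ∫⁻ a, (∫⁻ k : LinearMap.ker φ, f (fiberPoint φ a + k) ∂ν') ∂da :=
    lintegral_const_mul' (c : ℝ≥0∞) _ ENNReal.coe_ne_top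
  rw [e2, ← e', hb] at e
  have hpos : du (Metric.ball (0 : E) 1) ≠ 0 := (Metric.measure_ball_pos du 0 one_pos).ne'
  have hfin : du (Metric.ball (0 : E) 1) ≠ ∞ := measure_ball_lt_top.ne
  have c1 : (c : ℝ≥0∞) = 1 := by
    have : 1 * du (Metric.ball (0 : E) 1) = c * du (Metric.ball (0 : E) 1) := by
      rw [one_mul]; exact e
    exact ((ENNReal.mul_left_inj hpos hfin).1 this).symm
  have c1' : c = 1 := by exact_mod_cast c1
  rw [hc, c1', one_smul]

/-- The volume of a subset of a fibre does not depend on the base point. -/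
theorem fiberVolume_eq {φ : E →ₗ[ℝ] V} (hφ : Function.Surjective φ)
    (du : Measure E) (da : Measure V) [du.IsAddHaarMeasure] [da.IsAddHaarMeasure]
    {a : V} {u : E} (hu : φ u = a) (S : Set E) :
    fiberVolume φ du da a S = quotientMeasure φ du da {k | u + (k : E) ∈ S} := by
  have := (isQuotientMeasure_quotientMeasure hφ du da).1
  have hk : fiberPoint φ a - u ∈ LinearMap.ker φ := by
    simp [LinearMap.mem_ker, map_fiberPoint hφ, hu]
  rw [fiberVolume, ← measure_preimage_add (quotientMeasure φ du da)
    (⟨fiberPoint φ a - u, hk⟩ : LinearMap.ker φ) {k | u + (k : E) ∈ S}]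
  congr 1
  ext k
  have : u + (fiberPoint φ a - u + (k : E)) = fiberPoint φ a + k := by abel
  simp [this]

end Quotient

/-! ### Root system of type `A` and flow polytopes

The indices `1, …, r + 1` are the elements of `Fin (r + 1)`; the indices `1, …, r` are the elements
of `Fin r`, embedded by `Fin.castSucc`, and the index `r + 1` is `Fin.last r`. -/

/-- The space `V` of vectors in `ℝ^(r+1)` with coordinate sum `0`. -/
def V (r : ℕ) : Submodule ℝ (Fin (r + 1) → ℝ) where
  carrier := {a | ∑ i, a i = 0}
  zero_mem' := by simp
  add_mem' := by
    intro a b ha hb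
    simp only [Set.mem_ofPred_eq, Pi.add_apply, Finset.sum_add_distrib] at *
    rw [ha, hb, add_zero]
  smul_mem' := by
    intro c a ha
    simp only [Set.mem_ofPred_eq, Pi.smul_apply, smul_eq_mul] at *
    rw [← Finset.mul_sum, ha, mul_zero]

/-- The vector `e_i - e_j` of `V`; it is a positive root when `i < j`. -/
def root {r : ℕ} (i j : Fin (r + 1)) : V r :=
  ⟨Pi.single i 1 - Pi.single j 1, by
    change ∑ k, (Pi.single i 1 - Pi.single j 1 : Fin (r + 1) → ℝ) k = 0
    simp [Finset.sum_sub_distrib]⟩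

/-- The pairs `(i, j)` with `1 ≤ i < j ≤ r + 1`. -/
abbrev Pairs (r : ℕ) : Type := {p : Fin (r + 1) × Fin (r + 1) // p.1 < p.2}

/-- The lattice `V_ℤ` generated by the positive roots. -/
def rootLattice (r : ℕ) : Submodule ℤ (V r) :=
  Submodule.span ℤ (Set.range fun p : Pairs r => root p.1.1 p.1.2)

/-- The coordinates `(a_1, …, a_r)` of a vector `a = ∑_{i ≤ r} a_i (e_i - e_{r+1})` of `V`. -/
def coords {r : ℕ} (a : V r) : Fin r → ℝ := fun i => a.1 i.castSucc

/-- `V` is identified with `ℝ^r` by the coordinates `(a_1, …, a_r)`. -/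
def coordsEquiv (r : ℕ) : V r ≃ₗ[ℝ] (Fin r → ℝ) where
  toFun := coords
  map_add' _ _ := rfl
  map_smul' _ _ := rfl
  invFun x := ⟨Fin.snoc x (-∑ i, x i), by
    change ∑ k, (Fin.snoc x (-∑ i, x i) : Fin (r + 1) → ℝ) k = 0
    simp [Fin.sum_univ_castSucc]⟩
  left_inv := by
    rintro ⟨a, ha⟩
    have ha' : ∑ k, a k = 0 := ha
    rw [Fin.sum_univ_castSucc] at ha'
    ext k
    refine Fin.lastCases ?_ (fun i => ?_) k
    · simp [coords]; linarith
    · simp [coords]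
  right_inv := by
    intro x
    ext i
    simp [coords]

/-- The basis `e_i - e_{r+1}` (`1 ≤ i ≤ r`) of `V`. -/
def rootBasis (r : ℕ) : Module.Basis (Fin r) ℝ (V r) := Module.Basis.ofEquivFun (coordsEquiv r)

theorem rootBasis_apply {r : ℕ} (i : Fin r) :
    rootBasis r i = root i.castSucc (Fin.last r) := by
  apply (coordsEquiv r).injective
  rw [rootBasis, Module.Basis.coe_ofEquivFun, LinearEquiv.apply_symm_apply]
  ext j
  change _ = (Pi.single i.castSucc 1 - Pi.single (Fin.last r) 1 : Fin (r + 1) → ℝ) j.castSucc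
  simp [Pi.single_apply]

/-- The vectors `e_i - e_{r+1}` are a `ℤ`-basis of the lattice generated by the positive roots. -/
theorem span_rootBasis (r : ℕ) :
    Submodule.span ℤ (Set.range (rootBasis r)) = rootLattice r := by
  apply le_antisymm
  · rw [Submodule.span_le]
    rintro _ ⟨i, rfl⟩
    rw [rootBasis_apply]
    exact Submodule.subset_span ⟨⟨(i.castSucc, Fin.last r), Fin.castSucc_lt_last i⟩, rfl⟩
  · rw [rootLattice, Submodule.span_le]
    rintro _ ⟨⟨⟨i, j⟩, hij⟩, rfl⟩
    have key : ∀ k : Fin (r + 1),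
        root k (Fin.last r) ∈ Submodule.span ℤ (Set.range (rootBasis r)) := by
      intro k
      refine Fin.lastCases ?_ (fun l => ?_) k
      · have : root (Fin.last r) (Fin.last r) = 0 := by ext; simp [root]
        rw [this]; exact zero_mem _
      · rw [← rootBasis_apply]; exact Submodule.subset_span ⟨l, rfl⟩
    have : root i j = root i (Fin.last r) - root j (Fin.last r) := by ext; simp [root]
    change root i j ∈ _
    rw [this]
    exact sub_mem (key i) (key j)

/-- The Lebesgue measure `da` on `V` determined by the lattice `V_ℤ`: the parallelepiped spanned by
a `ℤ`-basis of `V_ℤ` has measure `1`. -/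
def latticeMeasure (r : ℕ) : Measure (V r) := (rootBasis r).addHaar

instance (r : ℕ) : (latticeMeasure r).IsAddHaarMeasure := by
  unfold latticeMeasure; infer_instance

/-- The index set of the coordinates `y_{i,j,k}` with `1 ≤ i < j ≤ r + 1` and
`1 ≤ k ≤ m_{i,j}`.  The values `m i j` with `j ≤ i` play no role. -/
abbrev Index {r : ℕ} (m : Fin (r + 1) → Fin (r + 1) → ℕ) : Type :=
  (p : Pairs r) × Fin (m p.1.1 p.1.2)

/-- `M = ∑_{i < j} m_{i,j}`. -/
def total {r : ℕ} (m : Fin (r + 1) → Fin (r + 1) → ℕ) : ℕ :=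
  ∑ p : Pairs r, m p.1.1 p.1.2

/-- The linear map `φ : ℝ^M → V`, `φ(y) = ∑ y_{i,j,k} (e_i - e_j)`. -/
def flowMap {r : ℕ} (m : Fin (r + 1) → Fin (r + 1) → ℕ) : (Index m → ℝ) →ₗ[ℝ] V r :=
  Fintype.linearCombination ℝ fun c : Index m => root c.1.1.1 c.1.1.2

/-- The flow polytope `P_{A_r^+, m}(a)`. -/
def polytope {r : ℕ} (m : Fin (r + 1) → Fin (r + 1) → ℕ) (a : V r) : Set (Index m → ℝ) :=
  {y | (∀ c, 0 ≤ y c) ∧ ∑ c : Index m, y c • root c.1.1.1 c.1.1.2 = a}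

/-- The volume `v_{A_r^+, m}(a)` of the flow polytope, for the measure `du / da` on `φ⁻¹(a)`, where
`du` is Lebesgue measure on `ℝ^M`. -/
def polytopeVolume {r : ℕ} (m : Fin (r + 1) → Fin (r + 1) → ℕ) (a : V r) : ℝ≥0∞ :=
  fiberVolume (flowMap m) volume (latticeMeasure r) a (polytope m a)

theorem flowMap_surjective {r : ℕ} {m : Fin (r + 1) → Fin (r + 1) → ℕ}
    (hm : ∀ i j, i < j → 0 < m i j) : Function.Surjective (flowMap m) := by
  rw [← LinearMap.range_eq_top, eq_top_iff, ← (rootBasis r).span_eq, Submodule.span_le]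
  rintro _ ⟨i, rfl⟩
  have h := Fin.castSucc_lt_last i
  refine ⟨Pi.single ⟨⟨(i.castSucc, Fin.last r), h⟩, ⟨0, hm _ _ h⟩⟩ 1, ?_⟩
  rw [flowMap, Fintype.linearCombination_apply_single, one_smul, rootBasis_apply]

/-- The nice chamber: `a_1, …, a_r > 0`. -/
def niceChamber (r : ℕ) : Set (V r) := {a | ∀ i : Fin r, 0 < a.1 i.castSucc}

/-- `v` is a polynomial in `a_1, …, a_r` that coincides with the (finite) volume of the flow
polytope for all `a` in the closure of the nice chamber. -/
def IsVolumePolynomial {r : ℕ} (m : Fin (r + 1) → Fin (r + 1) → ℕ)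
    (v : MvPolynomial (Fin r) ℝ) : Prop :=
  ∀ a ∈ closure (niceChamber r),
    polytopeVolume m a ≠ ∞ ∧ (polytopeVolume m a).toReal = MvPolynomial.eval (coords a) v

/-! ### The differential operators -/

/-- The operator `∂_i = ∂/∂a_i` on polynomials in `a_1, …, a_r`. -/
def partialD {r : ℕ} (i : Fin r) : Module.End ℝ (MvPolynomial (Fin r) ℝ) :=
  (MvPolynomial.pderiv i).toLinearMap

/-- The operator
`(∂_i - ∂_{i+1})^{m_{i,i+1}} (∂_i - ∂_{i+2})^{m_{i,i+2}} ⋯ (∂_i - ∂_r)^{m_{i,r}} ∂_i^{m_{i,r+1}}`,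
a product (composition) over `i < j ≤ r` in increasing order of `j`. -/
def diffOp {r : ℕ} (m : Fin (r + 1) → Fin (r + 1) → ℕ) (i : Fin r) :
    Module.End ℝ (MvPolynomial (Fin r) ℝ) :=
  (((List.finRange r).filter fun j => i < j).map fun j =>
      (partialD i - partialD j) ^ m i.castSucc j.castSucc).prod *
    partialD i ^ m i.castSucc (Fin.last r)

end FlowPolytope

end

noncomputable section

namespace FlowPolytope

/-! ### Directional derivatives of polynomials and their right inverses -/

section Polynomial

open MvPolynomial

variable {σ : Type*}

/-! The roots `e_i - e_{r+1}` form a basis of `V`, so on the fibre over `a` the `r` coordinates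
`y_{i,r+1,1}` are affine functions of the other `n = M - r` coordinates `u`. This change of
variables is unimodular, so the volume is the Lebesgue measure of the region `u ≥ 0`, `∑ u_c w_c ≤
a`, where `w_c` is the root of `c` in the coordinates `a_1, …, a_r` and the inequalities say that
the eliminated coordinates are nonnegative.

Order the free coordinates by increasing source and integrate out the outermost one, with source `i`
and root `w`. Later roots have nonnegative `i`-th coordinate, so the slice at `s` is empty for `s >
a_i`, and the volume is `∫_0^{a_i} G(a - s w) ds`, with `G` the volume function of the remaining
coordinates. This is the antiderivative of `G` along `w` vanishing on `a_i = 0`; by induction it is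
a polynomial whose degree grows by one at each step.

For the equation with index `i`, the operator is the product of the derivatives along the free roots
of source `i` and one extra `∂_i`, from the eliminated coordinate. These commute with the
antiderivatives of smaller source, the free ones undo the antiderivatives of source `i`, and `∂_i`
kills what is left, which depends only on later variables. -/

/-- The derivative of a polynomial in the direction `w`. -/
def dirDeriv (w : σ → ℝ) : Derivation ℝ (MvPolynomial σ ℝ) (MvPolynomial σ ℝ) :=
  mkDerivation ℝ fun k => C (w k)

@[simp]
theorem dirDeriv_X (w : σ → ℝ) (k : σ) : dirDeriv w (X k) = C (w k) :=
  mkDerivation_X _ _ _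

/-- The commutator of two derivations is a derivation, and it vanishes on the variables because
their derivatives are constants. -/
theorem dirDeriv_comm (w b : σ → ℝ) (G : MvPolynomial σ ℝ) :
    dirDeriv w (dirDeriv b G) = dirDeriv b (dirDeriv w G) := by
  have h : ⁅dirDeriv w, dirDeriv b⁆ = 0 := derivation_ext fun k => by
    simp [Derivation.commutator_apply, derivation_C]
  have := congrArg (fun D : Derivation ℝ (MvPolynomial σ ℝ) (MvPolynomial σ ℝ) => D G) h
  simpa [Derivation.commutator_apply, sub_eq_zero] using this

theorem dirDeriv_iterate_comm (w b : σ → ℝ) (n : ℕ) (G : MvPolynomial σ ℝ) :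
    dirDeriv b ((dirDeriv w)^[n] G) = (dirDeriv w)^[n] (dirDeriv b G) :=
  ((Function.Commute.iterate_right (f := dirDeriv b) (g := dirDeriv w)
    (fun G => dirDeriv_comm b w G) n)) G

theorem dirDeriv_isHomogeneous {w : σ → ℝ} {G : MvPolynomial σ ℝ} {d : ℕ}
    [Fintype σ] (hG : G.IsHomogeneous d) : (dirDeriv w G).IsHomogeneous (d - 1) := by
  have hs : ∀ H : MvPolynomial σ ℝ,
      (∑ k, w k • pderiv k : Derivation ℝ (MvPolynomial σ ℝ) (MvPolynomial σ ℝ)) H =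
        ∑ k, w k • pderiv k H := fun H => by
    simp only [← Derivation.coeFnAddMonoidHom_apply, map_sum, Finset.sum_apply]
    rfl
  have h : dirDeriv w = ∑ k, w k • pderiv k := derivation_ext fun j => by
    classical
    rw [hs, dirDeriv_X, Finset.sum_eq_single j]
    · simp [smul_eq_C_mul]
    · intro k _ hk
      simp [pderiv_X_of_ne hk.symm]
    · simp
  rw [h, hs]
  refine IsHomogeneous.sum _ _ _ fun k _ => ?_
  rw [smul_eq_C_mul]
  simpa using (isHomogeneous_C σ (w k)).mul (hG.pderiv (i := k))

theorem dirDeriv_iterate_isHomogeneous [Fintype σ] {w : σ → ℝ} {G : MvPolynomial σ ℝ} {d : ℕ}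
    (hG : G.IsHomogeneous d) (n : ℕ) : ((dirDeriv w)^[n] G).IsHomogeneous (d - n) := by
  induction n with
  | zero => simpa using hG
  | succ n ih =>
    rw [Function.iterate_succ_apply', Nat.sub_add_eq]
    exact dirDeriv_isHomogeneous ih

theorem dirDeriv_iterate_eq_zero [Fintype σ] {w : σ → ℝ} {G : MvPolynomial σ ℝ} {d : ℕ}
    (hG : G.IsHomogeneous d) : (dirDeriv w)^[d + 1] G = 0 := by
  have h := dirDeriv_iterate_isHomogeneous (w := w) hG d
  rw [Nat.sub_self] at h
  rw [Function.iterate_succ_apply', totalDegree_eq_zero_iff_eq_C.1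
    ((totalDegree_zero_iff_isHomogeneous _).2 h), derivation_C]

/-- The polynomial `∑_{n < N} (-1)ⁿ xᵢⁿ⁺¹ / (n + 1)! D_wⁿ G`.  If `w i = 1` and `D_w^N G = 0`, it is
the antiderivative of `G` in the direction `w` that vanishes for `xᵢ = 0`. -/
def antideriv (N : ℕ) (i : σ) (w : σ → ℝ) (G : MvPolynomial σ ℝ) : MvPolynomial σ ℝ :=
  ∑ n ∈ Finset.range N, C ((-1) ^ n / ((n + 1).factorial : ℝ)) * X i ^ (n + 1) *
    (dirDeriv w)^[n] G

@[simp]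
theorem antideriv_zero_right (N : ℕ) (i : σ) (w : σ → ℝ) : antideriv N i w 0 = 0 := by
  have h : ∀ n, (dirDeriv w)^[n] 0 = 0 := fun n => Function.iterate_fixed (map_zero _) n
  simp [antideriv, h]

/-- Repeated integration by parts: the derivatives of the summands telescope, leaving `G` minus a
multiple of `D_w^N G = 0`. -/
theorem dirDeriv_antideriv {N : ℕ} {i : σ} {w : σ → ℝ} {G : MvPolynomial σ ℝ} (hw : w i = 1)
    (hG : (dirDeriv w)^[N] G = 0) : dirDeriv w (antideriv N i w G) = G := by
  let t : ℕ → MvPolynomial σ ℝ := fun n =>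
    C ((-1) ^ n / (n.factorial : ℝ)) * X i ^ n * (dirDeriv w)^[n] G
  have h : ∀ n, dirDeriv w (C ((-1) ^ n / ((n + 1).factorial : ℝ)) * X i ^ (n + 1) *
      (dirDeriv w)^[n] G) = t n - t (n + 1) := by
    intro n
    have h1 : (C ((-1) ^ n / (n.factorial : ℝ)) : MvPolynomial σ ℝ) =
        C ((-1) ^ n / ((n + 1).factorial : ℝ)) * ((n + 1 : ℕ) : MvPolynomial σ ℝ) := by
      rw [← map_natCast (C : ℝ →+* MvPolynomial σ ℝ), ← C_mul, Nat.factorial_succ]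
      congr 1
      push_cast
      field_simp
    have h2 : (C ((-1) ^ (n + 1) / ((n + 1).factorial : ℝ)) : MvPolynomial σ ℝ) =
        - C ((-1) ^ n / ((n + 1).factorial : ℝ)) := by
      rw [← C_neg]
      congr 1
      ring
    simp only [t, h1, h2, Derivation.leibniz, Derivation.leibniz_pow, derivation_C, dirDeriv_X, hw,
      smul_eq_mul, nsmul_eq_mul, ← Function.iterate_succ_apply' (dirDeriv w), C_1,
      Nat.add_sub_cancel]
    ring
  rw [antideriv, map_sum, Finset.sum_congr rfl fun n _ => h n, Finset.sum_range_sub']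
  simp [t, hG]

/-- If `b i = 0`, then `X i` is a constant for `D_b`, and `D_b` commutes with the powers of `D_w`.
-/
theorem dirDeriv_antideriv_comm {N : ℕ} {i : σ} {w b : σ → ℝ} (G : MvPolynomial σ ℝ)
    (hb : b i = 0) : dirDeriv b (antideriv N i w G) = antideriv N i w (dirDeriv b G) := by
  simp only [antideriv, map_sum, Derivation.leibniz, Derivation.leibniz_pow, derivation_C,
    dirDeriv_X, hb, smul_eq_mul, map_zero, dirDeriv_iterate_comm]
  simp

theorem eval_antideriv_of_eq_zero {N : ℕ} {i : σ} {w : σ → ℝ} (G : MvPolynomial σ ℝ) {x : σ → ℝ}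
    (hx : x i = 0) : eval x (antideriv N i w G) = 0 := by
  simp [antideriv, hx]

theorem antideriv_isHomogeneous [Fintype σ] {i : σ} {w : σ → ℝ} {G : MvPolynomial σ ℝ}
    {d : ℕ} (hG : G.IsHomogeneous d) : (antideriv (d + 1) i w G).IsHomogeneous (d + 1) := by
  refine IsHomogeneous.sum _ _ _ fun n hn => ?_
  have hn' := Finset.mem_range.1 hn
  have h := ((isHomogeneous_C σ ((-1) ^ n / ((n + 1).factorial : ℝ))).mul
    ((isHomogeneous_X ℝ i).pow (n + 1))).mul (dirDeriv_iterate_isHomogeneous (w := w) hG n)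
  convert h using 1
  omega

theorem hasDerivAt_eval_line (x w : σ → ℝ) (G : MvPolynomial σ ℝ) (s : ℝ) :
    HasDerivAt (fun s : ℝ => eval (x - s • w) G) (-eval (x - s • w) (dirDeriv w G)) s := by
  induction G using MvPolynomial.induction_on with
  | C a => simpa [derivation_C] using hasDerivAt_const s a
  | add p q hp hq =>
    simp only [map_add, neg_add]
    exact hp.add hq
  | mul_X p k hp =>
    have h : HasDerivAt (fun s : ℝ => x k - s * w k) (-w k) s := by
      simpa using ((hasDerivAt_id s).mul_const (w k)).const_sub (x k)
    simp only [map_mul, eval_X, Pi.sub_apply, Pi.smul_apply, smul_eq_mul, Derivation.leibniz,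
      dirDeriv_X, map_add, eval_C]
    exact (hp.mul h).congr_deriv (by ring)

theorem continuous_eval_line (x w : σ → ℝ) (G : MvPolynomial σ ℝ) :
    Continuous fun s : ℝ => eval (x - s • w) G :=
  continuous_iff_continuousAt.2 fun s => (hasDerivAt_eval_line x w G s).continuousAt

/-- The fundamental theorem of calculus on the segment from `x` to `x - x i • w`, whose endpoint
lies on the hyperplane where the antiderivative vanishes. -/
theorem eval_antideriv {N : ℕ} {i : σ} {w : σ → ℝ} {G : MvPolynomial σ ℝ} (hw : w i = 1)
    (hG : (dirDeriv w)^[N] G = 0) (x : σ → ℝ) :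
    eval x (antideriv N i w G) = ∫ s in (0 : ℝ)..x i, eval (x - s • w) G := by
  have h := intervalIntegral.integral_eq_sub_of_hasDerivAt (a := 0) (b := x i)
    (fun s _ => hasDerivAt_eval_line x w (antideriv N i w G) s)
    ((continuous_eval_line x w _).neg.intervalIntegrable _ _)
  rw [dirDeriv_antideriv hw hG, intervalIntegral.integral_neg,
    eval_antideriv_of_eq_zero (x := x - x i • w) G (by simp [hw])] at h
  simp only [zero_smul, sub_zero, zero_sub, neg_inj] at h
  exact h.symm

/-- The iterated antiderivative of `1` along the directions `c.2`, `c ∈ l`, where the antiderivative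
for `c` vanishes on the hyperplane of coordinate `c.1`. -/
def iteratedAntideriv : List (σ × (σ → ℝ)) → MvPolynomial σ ℝ
  | [] => 1
  | c :: l => antideriv (l.length + 1) c.1 c.2 (iteratedAntideriv l)

theorem iteratedAntideriv_isHomogeneous [Fintype σ] (l : List (σ × (σ → ℝ))) :
    (iteratedAntideriv l).IsHomogeneous l.length := by
  induction l with
  | nil => exact isHomogeneous_one σ ℝ
  | cons c l ih => exact antideriv_isHomogeneous ih

theorem dirDeriv_iteratedAntideriv_eq_zero {l : List (σ × (σ → ℝ))} {b : σ → ℝ}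
    (h : ∀ c ∈ l, b c.1 = 0) : dirDeriv b (iteratedAntideriv l) = 0 := by
  induction l with
  | nil => exact Derivation.map_one_eq_zero _
  | cons c l ih =>
    rw [iteratedAntideriv, dirDeriv_antideriv_comm _ (h c List.mem_cons_self),
      ih fun d hd => h d (List.mem_cons_of_mem _ hd), antideriv_zero_right]

/-- The composition of the directional derivatives along the vectors of a list. -/
def dirDerivProd (L : List (σ → ℝ)) : Module.End ℝ (MvPolynomial σ ℝ) :=
  (L.map fun w => (dirDeriv w).toLinearMap).prod

theorem dirDerivProd_perm {L L' : List (σ → ℝ)} (h : L.Perm L') :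
    dirDerivProd L = dirDerivProd L' := by
  refine (h.map _).prod_eq' (List.pairwise_of_forall_mem_list ?_)
  simp only [List.mem_map]
  rintro _ ⟨w, -, rfl⟩ _ ⟨b, -, rfl⟩
  exact LinearMap.ext fun G => dirDeriv_comm w b G

theorem dirDerivProd_cons (w : σ → ℝ) (L : List (σ → ℝ)) (G : MvPolynomial σ ℝ) :
    dirDerivProd (w :: L) G = dirDeriv w (dirDerivProd L G) := rfl

theorem dirDerivProd_cons' (w : σ → ℝ) (L : List (σ → ℝ)) (G : MvPolynomial σ ℝ) :
    dirDerivProd (w :: L) G = dirDerivProd L (dirDeriv w G) := by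
  rw [dirDerivProd_perm (List.perm_append_singleton w L).symm]
  simp [dirDerivProd]

theorem dirDerivProd_antideriv_comm {N : ℕ} {i : σ} {w : σ → ℝ} {L : List (σ → ℝ)}
    (hL : ∀ b ∈ L, b i = 0) (G : MvPolynomial σ ℝ) :
    dirDerivProd L (antideriv N i w G) = antideriv N i w (dirDerivProd L G) := by
  induction L with
  | nil => rfl
  | cons b L ih =>
    rw [dirDerivProd_cons, ih fun b hb => hL b (List.mem_cons_of_mem _ hb),
      dirDeriv_antideriv_comm _ (hL b List.mem_cons_self), dirDerivProd_cons]

/-- The derivatives in the directions with source `i`, followed by a derivative that does not see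
the later sources, annihilate the iterated antiderivative. -/
theorem dirDerivProd_iteratedAntideriv_eq_zero [Fintype σ] [LinearOrder σ]
    {l : List (σ × (σ → ℝ))}
    (hl : l.Pairwise fun c d => c.1 ≤ d.1) (h1 : ∀ c ∈ l, c.2 c.1 = 1)
    (h0 : ∀ c ∈ l, ∀ k < c.1, c.2 k = 0) (i : σ) {b : σ → ℝ} (hb : ∀ k, k ≠ i → b k = 0) :
    dirDerivProd (b :: (l.filter fun c => c.1 = i).map Prod.snd) (iteratedAntideriv l) = 0 := by
  induction l with
  | nil => exact Derivation.map_one_eq_zero _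
  | cons c l ih =>
    rw [List.pairwise_cons] at hl
    have ih := ih hl.2 (fun d hd => h1 d (List.mem_cons_of_mem _ hd))
      (fun d hd => h0 d (List.mem_cons_of_mem _ hd))
    rcases lt_trichotomy c.1 i with hc | hc | hc
    -- Source before `i`: no derivative in the product has a component along `c.1`, so all pass
    -- through the outer antiderivative.
    · rw [List.filter_cons_of_neg (by simpa using hc.ne), iteratedAntideriv,
        dirDerivProd_antideriv_comm _, ih, antideriv_zero_right]
      intro w hw
      rw [List.mem_cons, List.mem_map] at hw
      rcases hw with rfl | ⟨d, hd, rfl⟩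
      · exact hb _ hc.ne
      · simp only [List.mem_filter, decide_eq_true_eq] at hd
        exact h0 d (List.mem_cons_of_mem _ hd.1) _ (hd.2 ▸ hc)
    -- Source `i`: the derivative along `c.2` cancels the outer antiderivative.
    · rw [List.filter_cons_of_pos (by simpa using hc), List.map_cons,
        dirDerivProd_perm (List.Perm.swap _ _ _), dirDerivProd_cons', iteratedAntideriv,
        dirDeriv_antideriv (h1 c List.mem_cons_self)
          (dirDeriv_iterate_eq_zero (iteratedAntideriv_isHomogeneous l)), ih]
    -- All remaining sources exceed `i`: `D_b` passes through every antiderivative and kills the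
    -- constant `1`.
    · have hne : ∀ d ∈ c :: l, i < d.1 := by
        intro d hd
        rcases List.mem_cons.1 hd with rfl | hd
        · exact hc
        · exact hc.trans_le (hl.1 d hd)
      rw [dirDerivProd_cons', dirDeriv_iteratedAntideriv_eq_zero fun d hd => hb _ (hne d hd).ne',
        map_zero]

end Polynomial

/-! ### The volume of a polytope cut out of an orthant -/

section Orthant

open MvPolynomial

variable {σ : Type*}

/-- The points `u ≥ 0` with `∑ u c • w c ≤ x`. -/
def orthantRegion {κ : Type*} [Fintype κ] (w : κ → σ → ℝ) (x : σ → ℝ) : Set (κ → ℝ) :=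
  {u | (∀ c, 0 ≤ u c) ∧ ∀ k, ∑ c, u c * w c k ≤ x k}

theorem measurableSet_orthantRegion {κ : Type*} [Fintype κ] (w : κ → σ → ℝ) (x : σ → ℝ) :
    MeasurableSet (orthantRegion w x) := by
  refine IsClosed.measurableSet ?_
  simp only [orthantRegion, Set.ofPred_and, Set.ofPred_forall]
  refine (isClosed_iInter fun c => isClosed_le (by fun_prop) (by fun_prop)).inter
    (isClosed_iInter fun k => isClosed_le (by fun_prop) (by fun_prop))

theorem cons_mem_orthantRegion {n : ℕ} (w : Fin (n + 1) → σ → ℝ) (x : σ → ℝ) (s : ℝ)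
    (u : Fin n → ℝ) : (Fin.cons s u : Fin (n + 1) → ℝ) ∈ orthantRegion w x ↔
      0 ≤ s ∧ u ∈ orthantRegion (Fin.tail w) (x - s • w 0) := by
  simp only [orthantRegion, Set.mem_ofPred_eq, Fin.forall_fin_succ, Fin.cons_zero, Fin.cons_succ,
    Fin.sum_univ_succ, Pi.sub_apply, Pi.smul_apply, smul_eq_mul, Fin.tail, and_assoc]
  simp only [le_sub_iff_add_le']

theorem volume_orthantRegion_succ {n : ℕ} (w : Fin (n + 1) → σ → ℝ) (x : σ → ℝ) :
    volume (orthantRegion w x) =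
      ∫⁻ s in Set.Ici (0 : ℝ), volume (orthantRegion (Fin.tail w) (x - s • w 0)) := by
  have hmp := (volume_preserving_piFinSuccAbove (fun _ : Fin (n + 1) => ℝ) 0).symm
  rw [← hmp.measure_preimage_equiv, Measure.volume_eq_prod, Measure.prod_apply
    ((MeasurableEquiv.measurable _) (measurableSet_orthantRegion w x)),
    ← lintegral_indicator measurableSet_Ici]
  refine lintegral_congr fun s => ?_
  have h : Prod.mk s ⁻¹' ((MeasurableEquiv.piFinSuccAbove (fun _ : Fin (n + 1) => ℝ) 0).symm ⁻¹'
      orthantRegion w x) = {u | 0 ≤ s ∧ u ∈ orthantRegion (Fin.tail w) (x - s • w 0)} := by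
    ext u
    rw [Set.mem_ofPred_eq, ← cons_mem_orthantRegion]
    simp [MeasurableEquiv.piFinSuccAbove, Fin.consEquiv]
  rw [h]
  by_cases hs : 0 ≤ s <;> simp [hs]

/-- Tonelli in the first coordinate matches the recursion of `iteratedAntideriv`. The signs in
`hneg` keep `x - s • w` in the orthant for `0 ≤ s ≤ x i`, so that induction applies; `hP` makes the
slices with `s > x i` empty. -/
theorem volume_orthantRegion [Fintype σ] {n : ℕ} (e : Fin n → σ × (σ → ℝ))
    (h1 : ∀ c, (e c).2 (e c).1 = 1) (hneg : ∀ c k, k ≠ (e c).1 → (e c).2 k ≤ 0)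
    (hP : ∀ a b, a < b → 0 ≤ (e b).2 (e a).1) {x : σ → ℝ} (hx : ∀ k, 0 ≤ x k) :
    0 ≤ eval x (iteratedAntideriv (List.ofFn e)) ∧
      volume (orthantRegion (fun c => (e c).2) x) =
        ENNReal.ofReal (eval x (iteratedAntideriv (List.ofFn e))) := by
  induction n generalizing x with
  | zero =>
    -- With no coordinates left the region is the single point of `ℝ^0`, of volume `1`; this uses `x
    -- ≥ 0`.
    have h : orthantRegion (fun c => (e c).2) x = {0} := by
      ext u
      simp [orthantRegion, hx, Subsingleton.elim u 0]
    rw [h]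
    rw [volume_pi, Measure.pi_of_empty (fun _ : Fin 0 => volume) 0]
    simp [iteratedAntideriv]
  | succ n ih =>
    rw [List.ofFn_succ, iteratedAntideriv]
    have hline : ∀ s ∈ Set.Icc 0 (x (e 0).1), ∀ k, 0 ≤ (x - s • (e 0).2) k := by
      rintro s ⟨hs0, hs⟩ k
      simp only [Pi.sub_apply, Pi.smul_apply, smul_eq_mul]
      by_cases hk : k = (e 0).1
      · rw [hk, h1]
        linarith
      · nlinarith [hx k, hneg 0 k hk]
    have ih := fun s (hs : s ∈ Set.Icc 0 (x (e 0).1)) =>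
      ih (fun c => e c.succ) (fun c => h1 _) (fun c => hneg _)
        (fun a b hab => hP _ _ (Fin.succ_lt_succ_iff.2 hab)) (hline s hs)
    set G := iteratedAntideriv (List.ofFn fun c : Fin n => e c.succ) with hG
    rw [eval_antideriv (h1 0) (dirDeriv_iterate_eq_zero (iteratedAntideriv_isHomogeneous _)), ← hG,
      intervalIntegral.integral_of_le (hx _), ← integral_Icc_eq_integral_Ioc]
    refine ⟨setIntegral_nonneg measurableSet_Icc fun s hs => (ih s hs).1, ?_⟩
    rw [ofReal_integral_eq_lintegral_ofReal
      ((continuous_eval_line x (e 0).2 G).continuousOn.integrableOn_compact isCompact_Icc)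
      ((ae_restrict_iff' measurableSet_Icc).2 (Filter.Eventually.of_forall fun s hs => (ih s hs).1)),
      volume_orthantRegion_succ, ← lintegral_indicator measurableSet_Ici,
      ← lintegral_indicator measurableSet_Icc]
    refine lintegral_congr fun s => ?_
    by_cases hs : s ∈ Set.Icc 0 (x (e 0).1)
    · rw [Set.indicator_of_mem hs, Set.indicator_of_mem (Set.mem_Ici.2 hs.1), ← (ih s hs).2]
      rfl
    · rw [Set.indicator_of_notMem hs]
      by_cases hs0 : s ∈ Set.Ici (0 : ℝ)
      · rw [Set.indicator_of_mem hs0]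
        convert measure_empty (μ := volume)
        rw [Set.eq_empty_iff_forall_notMem]
        rintro u ⟨hu, hu'⟩
        have h := hu' (e 0).1
        have hsum : 0 ≤ ∑ c, u c * (Fin.tail (fun c => (e c).2)) c (e 0).1 :=
          Finset.sum_nonneg fun c _ => mul_nonneg (hu c) (hP 0 c.succ (Fin.succ_pos c))
        have hlt : x (e 0).1 < s := not_le.1 fun h => hs ⟨hs0, h⟩
        simp only [Pi.sub_apply, Pi.smul_apply, smul_eq_mul, h1] at h
        linarith
      · rw [Set.indicator_of_notMem hs0]

end Orthant

/-! ### The quotient measure in coordinates -/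

section Coordinates

variable {ι σ κ V : Type*} [Fintype σ] [Fintype κ] [DecidableEq ι]
  [NormedAddCommGroup V] [NormedSpace ℝ V]

/-- The point of `ι → ℝ` over `a` with free coordinates `u`, for a linear map that sends the
standard basis vectors of the coordinates in `σ` to the basis `b`. -/
def graphPoint (φ : (ι → ℝ) →ₗ[ℝ] V) (b : Module.Basis σ ℝ V) (ε : σ ⊕ κ ≃ ι) :
    (V × (κ → ℝ)) →ₗ[ℝ] (ι → ℝ) :=
  LinearMap.pi fun c => Sum.elim
    (fun i => LinearMap.proj i ∘ₗ b.equivFun.toLinearMap ∘ₗ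
      (LinearMap.fst ℝ V (κ → ℝ) - (Fintype.linearCombination ℝ fun k =>
        φ (Pi.single (ε (Sum.inr k)) 1)) ∘ₗ LinearMap.snd ℝ V (κ → ℝ)))
    (fun k => LinearMap.proj k ∘ₗ LinearMap.snd ℝ V (κ → ℝ)) (ε.symm c)

variable {φ : (ι → ℝ) →ₗ[ℝ] V} {b : Module.Basis σ ℝ V} {ε : σ ⊕ κ ≃ ι}

@[simp]
theorem graphPoint_inr (a : V) (u : κ → ℝ) (k : κ) :
    graphPoint φ b ε (a, u) (ε (Sum.inr k)) = u k := by
  simp [graphPoint]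

@[simp]
theorem graphPoint_inl (a : V) (u : κ → ℝ) (i : σ) :
    graphPoint φ b ε (a, u) (ε (Sum.inl i)) =
      b.equivFun a i - ∑ k, u k * b.equivFun (φ (Pi.single (ε (Sum.inr k)) 1)) i := by
  simp [graphPoint, Fintype.linearCombination_apply]

variable [Fintype ι]

theorem map_eq_sum_add_sum (hφ : ∀ i, φ (Pi.single (ε (Sum.inl i)) 1) = b i) (y : ι → ℝ) :
    φ y = ∑ i, y (ε (Sum.inl i)) • b i +
      ∑ k, y (ε (Sum.inr k)) • φ (Pi.single (ε (Sum.inr k)) 1) := by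
  rw [LinearMap.pi_apply_eq_sum_univ φ y, ← Equiv.sum_comp ε, Fintype.sum_sum_type]
  have h : ∀ c : ι, (fun j => if c = j then (1 : ℝ) else 0) = Pi.single c 1 := fun c => by
    ext j
    simp [Pi.single_apply, eq_comm]
  simp only [h, hφ]

theorem map_graphPoint (hφ : ∀ i, φ (Pi.single (ε (Sum.inl i)) 1) = b i) (p : V × (κ → ℝ)) :
    φ (graphPoint φ b ε p) = p.1 := by
  obtain ⟨a, u⟩ := p
  rw [map_eq_sum_add_sum hφ]
  simp only [graphPoint_inl, graphPoint_inr, sub_smul, Finset.sum_sub_distrib, b.sum_equivFun,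
    Finset.sum_smul]
  rw [Finset.sum_comm]
  simp only [mul_smul, ← Finset.smul_sum, b.sum_equivFun, sub_add_cancel]

/-- The free coordinates parametrize the kernel. -/
def kerEquiv (hφ : ∀ i, φ (Pi.single (ε (Sum.inl i)) 1) = b i) :
    (κ → ℝ) ≃ₗ[ℝ] LinearMap.ker φ where
  toFun u := ⟨graphPoint φ b ε (0, u), map_graphPoint hφ _⟩
  map_add' u u' := by
    ext1
    rw [Submodule.coe_add, ← map_add]
    simp
  map_smul' t u := by
    ext1
    rw [RingHom.id_apply, Submodule.coe_smul, ← map_smul]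
    simp
  invFun y k := y.1 (ε (Sum.inr k))
  left_inv u := by ext k; simp
  right_inv := by
    rintro ⟨y, hy⟩
    ext c
    obtain ⟨c | k, rfl⟩ := ε.surjective c
    -- The `c`-th coordinate of `φ y = 0` in the basis `b` determines the dependent coordinate.
    · have h := map_eq_sum_add_sum hφ y
      rw [LinearMap.mem_ker.1 hy] at h
      have h' := congrArg (fun a => b.equivFun a c) h
      classical
      simp only [map_zero, Pi.zero_apply, map_add, map_sum, map_smul, Pi.add_apply, Finset.sum_apply,
        Pi.smul_apply, Module.Basis.equivFun_self, smul_eq_mul, mul_ite, mul_one, mul_zero,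
        Finset.sum_ite_eq', Finset.mem_univ, if_true] at h'
      simp only [graphPoint_inl, map_zero, Pi.zero_apply]
      linarith
    · simp

variable [FiniteDimensional ℝ V] [MeasurableSpace V] [BorelSpace V]

theorem measurePreserving_equivFun (b : Module.Basis σ ℝ V) :
    MeasurePreserving (b.equivFun : V → σ → ℝ) b.addHaar volume := by
  classical
  refine ⟨b.equivFun.toContinuousLinearEquiv.continuous.measurable, ?_⟩
  have h := b.map_addHaar b.equivFun.toContinuousLinearEquiv
  have hb : b.map b.equivFun.toContinuousLinearEquiv.toLinearEquiv = Pi.basisFun ℝ σ := by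
    ext i j
    simp [Pi.single_apply, eq_comm]
  rw [hb, (Pi.basisFun ℝ σ).addHaar_def, Module.Basis.parallelepiped_basisFun,
    addHaarMeasure_eq_volume_pi] at h
  exact h

/-- Up to the isometric reading of `V` in the basis `b` and a relabelling of coordinates, this is
the shear `(u, x) ↦ (u, x - A u)`, which translates each fibre over `u`. -/
theorem measurePreserving_graphPoint :
    MeasurePreserving (graphPoint φ b ε) (b.addHaar.prod volume) volume := by
  classical
  let A : (κ → ℝ) → σ → ℝ := fun u i => ∑ k, u k * b.equivFun (φ (Pi.single (ε (Sum.inr k)) 1)) i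
  have hA : Measurable A := by fun_prop
  have h1 : MeasurePreserving (Prod.map b.equivFun id : V × (κ → ℝ) → (σ → ℝ) × (κ → ℝ))
      (b.addHaar.prod volume) (volume.prod volume) :=
    (measurePreserving_equivFun b).prod (MeasurePreserving.id _)
  have h2 : MeasurePreserving (fun p : (κ → ℝ) × (σ → ℝ) => (p.1, p.2 - A p.1))
      (volume.prod volume) (volume.prod volume) :=
    (MeasurePreserving.id _).skew_product (g := fun u x => x - A u)
      (measurable_snd.sub (hA.comp measurable_fst))
      (Filter.Eventually.of_forall fun u => (measurePreserving_sub_right volume (A u)).map_eq)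
  have h3 := (volume_measurePreserving_piCongrLeft (fun _ : ι => ℝ) ε).comp
    ((volume_measurePreserving_sumPiEquivProdPi_symm (fun _ : σ ⊕ κ => ℝ)).comp
      ((Measure.measurePreserving_swap (μ := (volume : Measure (κ → ℝ)))
        (ν := (volume : Measure (σ → ℝ)))).comp
        (h2.comp (Measure.measurePreserving_swap.comp h1))))
  convert h3 using 1
  ext ⟨a, u⟩ c
  obtain ⟨c | k, rfl⟩ := ε.surjective c
  · rw [graphPoint_inl]
    simp [A, MeasurableEquiv.coe_piCongrLeft, Equiv.piCongrLeft_apply_apply]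
    rfl
  · rw [graphPoint_inr]
    simp [MeasurableEquiv.coe_piCongrLeft, Equiv.piCongrLeft_apply_apply]
    rfl

theorem isQuotientMeasure_map_kerEquiv (hφ : ∀ i, φ (Pi.single (ε (Sum.inl i)) 1) = b i) :
    IsQuotientMeasure φ volume b.addHaar (Measure.map (kerEquiv hφ) volume) := by
  have hs : Function.Surjective φ := fun a => ⟨_, map_graphPoint (ε := ε) hφ (a, 0)⟩
  have hH : (Measure.map (kerEquiv hφ) volume).IsAddHaarMeasure :=
    (kerEquiv hφ).toContinuousLinearEquiv.isAddHaarMeasure_map volume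
  refine ⟨hH, fun f hf => ?_⟩
  have hm : Measurable (kerEquiv hφ) :=
    (kerEquiv hφ).toContinuousLinearEquiv.continuous.measurable
  have hg := measurePreserving_graphPoint (φ := φ) (b := b) (ε := ε)
  rw [← hg.lintegral_comp hf, lintegral_prod (fun p => f (graphPoint φ b ε p)) (hf.comp hg.measurable).aemeasurable]
  refine lintegral_congr fun a => ?_
  rw [lintegral_fiber_eq hs _ f (map_graphPoint (ε := ε) hφ (a, 0)), lintegral_map (by fun_prop) hm]
  refine lintegral_congr fun u => ?_
  change f _ = f (graphPoint φ b ε (a, 0) + graphPoint φ b ε (0, u))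
  rw [← map_add]
  simp

/-- Uniqueness of the quotient measure identifies it with Lebesgue measure in the free coordinates,
and the volume is independent of the base point. -/
theorem fiberVolume_eq_volume (hφ : ∀ i, φ (Pi.single (ε (Sum.inl i)) 1) = b i) (a : V)
    (S : Set (ι → ℝ)) : fiberVolume φ volume b.addHaar a S =
      volume {u : κ → ℝ | graphPoint φ b ε (a, u) ∈ S} := by
  have hs : Function.Surjective φ := fun a => ⟨_, map_graphPoint (ε := ε) hφ (a, 0)⟩
  rw [fiberVolume_eq hs _ _ (map_graphPoint (ε := ε) hφ (a, 0)),
    (isQuotientMeasure_quotientMeasure hs volume b.addHaar).unique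
      (isQuotientMeasure_map_kerEquiv hφ),
    show Measure.map (kerEquiv hφ) volume = Measure.map
      (kerEquiv hφ).toContinuousLinearEquiv.toHomeomorph.toMeasurableEquiv volume from rfl,
    MeasurableEquiv.map_apply]
  congr 1
  ext u
  change graphPoint φ b ε (a, 0) + graphPoint φ b ε (0, u) ∈ S ↔ graphPoint φ b ε (a, u) ∈ S
  rw [← map_add]
  simp

end Coordinates

/-! ### The volume polynomial of a flow polytope -/

section VolumePolynomial

variable {r : ℕ} {m : Fin (r + 1) → Fin (r + 1) → ℕ}

/-! ### Positive roots in coordinates and the ordering of the free variables. -/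

theorem coords_root (i j : Fin (r + 1)) (k : Fin r) :
    coords (root i j) k =
      (if k.castSucc = i then 1 else 0) - (if k.castSucc = j then 1 else 0) := by
  simp [coords, root, Pi.single_apply]

/-- The index `i` of a positive root `e_i - e_j`, as an element of `{1, …, r}`. -/
def source (p : Pairs r) : Fin r := p.1.1.castPred (p.2.trans_le (Fin.le_last _)).ne

@[simp]
theorem castSucc_source (p : Pairs r) : (source p).castSucc = p.1.1 := Fin.castSucc_castPred _ _

/-- The source and the coordinates of a positive root. -/
def rootDirection (p : Pairs r) : Fin r × (Fin r → ℝ) := (source p, coords (root p.1.1 p.1.2))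

theorem rootDirection_source (p : Pairs r) : (rootDirection p).2 (rootDirection p).1 = 1 := by
  simp [rootDirection, coords_root, p.2.ne]

theorem rootDirection_nonpos (p : Pairs r) {k : Fin r} (hk : k ≠ (rootDirection p).1) :
    (rootDirection p).2 k ≤ 0 := by
  have h : k.castSucc ≠ p.1.1 := by
    rw [← castSucc_source p]
    exact fun h => hk (Fin.castSucc_injective _ h)
  simp only [rootDirection, coords_root, if_neg h, zero_sub, Left.neg_nonpos_iff]
  split_ifs <;> norm_num

theorem rootDirection_nonneg (p : Pairs r) {k : Fin r} (hk : k ≤ (rootDirection p).1) :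
    0 ≤ (rootDirection p).2 k := by
  have h : k.castSucc < p.1.2 :=
    (Fin.castSucc_le_castSucc_iff.2 hk).trans_lt ((castSucc_source p).trans_lt p.2)
  simp only [rootDirection, coords_root, if_neg h.ne, sub_zero]
  split_ifs <;> norm_num

theorem rootDirection_eq_zero (p : Pairs r) {k : Fin r} (hk : k < (rootDirection p).1) :
    (rootDirection p).2 k = 0 :=
  le_antisymm (rootDirection_nonpos p hk.ne) (rootDirection_nonneg p hk.le)

/-- The index `(i, r + 1, 1)` in `Index m`. -/
def sinkIndex (hm : ∀ i j : Fin (r + 1), i < j → 0 < m i j) (i : Fin r) : Index m :=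
  ⟨⟨(i.castSucc, Fin.last r), Fin.castSucc_lt_last i⟩, ⟨0, hm _ _ (Fin.castSucc_lt_last i)⟩⟩

theorem sinkIndex_injective (hm : ∀ i j : Fin (r + 1), i < j → 0 < m i j) :
    Function.Injective (sinkIndex hm) := fun i j h => by
  have h' := congrArg (fun c : Index m => c.1.1.1) h
  exact Fin.castSucc_injective _ h'

/-- Sorting the complement of the sink indices by source gives the order of integration. -/
theorem exists_equiv_monotone_source (hm : ∀ i j : Fin (r + 1), i < j → 0 < m i j) :
    ∃ (n : ℕ) (ε : Fin r ⊕ Fin n ≃ Index m), (∀ i, ε (Sum.inl i) = sinkIndex hm i) ∧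
      Monotone fun k => source (ε (Sum.inr k)).1 := by
  classical
  let κ := ((Set.range (sinkIndex hm))ᶜ : Set (Index m))
  let e : Fin (Fintype.card κ) ≃ κ := (Fintype.equivFin κ).symm
  let s : Fin (Fintype.card κ) → Fin r := fun k => source (e k).1.1
  refine ⟨_, ((Equiv.ofInjective _ (sinkIndex_injective hm)).sumCongr
    ((Tuple.sort s).trans e)).trans (Equiv.Set.sumCompl _), fun i => ?_, ?_⟩
  · exact Equiv.Set.sumCompl_apply_inl _ _
  · simpa using! Tuple.monotone_sort s

theorem card_index : Fintype.card (Index m) = total m := by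
  simp [total]

theorem sum_filter_map {α β : Type*} (p : α → Prop) [DecidablePred p] (g : α → β)
    (l : List α) : ((l.filter p).map g : Multiset β) =
      (l.map fun a => if p a then ({g a} : Multiset β) else 0).sum := by
  induction l with
  | nil => rfl
  | cons a l ih =>
    by_cases h : p a
    · rw [List.filter_cons_of_pos (by simpa using h), List.map_cons, List.map_cons, List.sum_cons,
        ← ih, if_pos h]
      rfl
    · rw [List.filter_cons_of_neg (by simpa using h), List.map_cons, List.sum_cons, ← ih, if_neg h,
        zero_add]

/-! ### The differential operators as products of derivatives along roots. -/

theorem partialD_eq_dirDeriv (i : Fin r) :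
    partialD i = (dirDeriv (coords (root i.castSucc (Fin.last r)))).toLinearMap := by
  rw [partialD]
  congr 1
  refine MvPolynomial.derivation_ext fun k => ?_
  rw [dirDeriv_X, coords_root, if_neg (Fin.castSucc_lt_last k).ne]
  rcases eq_or_ne k i with rfl | h
  · simp
  · simp [MvPolynomial.pderiv_X_of_ne h, h]

theorem partialD_sub_eq_dirDeriv (i j : Fin r) :
    partialD i - partialD j = (dirDeriv (coords (root i.castSucc j.castSucc))).toLinearMap := by
  have h : MvPolynomial.pderiv i - MvPolynomial.pderiv j =
      dirDeriv (coords (root i.castSucc j.castSucc)) := by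
    refine MvPolynomial.derivation_ext fun k => ?_
    have hX : ∀ l : Fin r, MvPolynomial.pderiv l (MvPolynomial.X k : MvPolynomial (Fin r) ℝ) =
        MvPolynomial.C (if k.castSucc = l.castSucc then 1 else 0) := fun l => by
      rcases eq_or_ne k l with rfl | h
      · simp
      · simp [MvPolynomial.pderiv_X_of_ne h, h]
    rw [dirDeriv_X, coords_root, Derivation.sub_apply, hX, hX, MvPolynomial.C_sub]
  rw [← h]
  rfl

/-- The vectors of the directional derivatives whose product is `diffOp m i`. -/
def diffOpDirections (m : Fin (r + 1) → Fin (r + 1) → ℕ) (i : Fin r) : List (Fin r → ℝ) :=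
  (((List.finRange r).filter fun j => i < j).flatMap fun j =>
    List.replicate (m i.castSucc j.castSucc) (coords (root i.castSucc j.castSucc))) ++
  List.replicate (m i.castSucc (Fin.last r)) (coords (root i.castSucc (Fin.last r)))

theorem diffOp_eq (m : Fin (r + 1) → Fin (r + 1) → ℕ) (i : Fin r) :
    diffOp m i = dirDerivProd (diffOpDirections m i) := by
  rw [dirDerivProd, diffOpDirections, List.map_append, List.prod_append, List.map_replicate,
    List.prod_replicate, ← partialD_eq_dirDeriv, diffOp]
  congr 1
  generalize (List.finRange r).filter (fun j => i < j) = l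
  induction l with
  | nil => rfl
  | cons j l ih =>
    rw [List.map_cons, List.prod_cons, ih, List.flatMap_cons, List.map_append, List.prod_append,
      List.map_replicate, List.prod_replicate, partialD_sub_eq_dirDeriv]

/-- As a multiset, the directions are the roots of source `i` with multiplicity; a sum over `Index
m` can then be split along `ε`. -/
theorem coe_diffOpDirections (m : Fin (r + 1) → Fin (r + 1) → ℕ) (i : Fin r) :
    (diffOpDirections m i : Multiset (Fin r → ℝ)) =
      ∑ c : Index m, if (rootDirection c.1).1 = i then {(rootDirection c.1).2} else 0 := by
  let G : Fin (r + 1) → Fin (r + 1) → Multiset (Fin r → ℝ) := fun a b =>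
    if a = i.castSucc then m a b • {coords (root a b)} else 0
  have h1 : ∀ p : Pairs r, (∑ _k : Fin (m p.1.1 p.1.2),
      if (rootDirection p).1 = i then {(rootDirection p).2} else 0) = G p.1.1 p.1.2 := by
    intro p
    have : source p = i ↔ p.1.1 = i.castSucc := by
      rw [← castSucc_source p, Fin.castSucc_inj]
    simp only [rootDirection, G, this, Finset.sum_const, Finset.card_univ, Fintype.card_fin,
      smul_ite, smul_zero]
  have h2 : (diffOpDirections m i : Multiset (Fin r → ℝ)) =
      (∑ j : Fin r, if i < j then m i.castSucc j.castSucc •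
        ({coords (root i.castSucc j.castSucc)} : Multiset (Fin r → ℝ)) else 0) +
      m i.castSucc (Fin.last r) • {coords (root i.castSucc (Fin.last r))} := by
    rw [diffOpDirections, ← Multiset.coe_add, Fin.sum_univ_def, Multiset.coe_replicate,
      Multiset.nsmul_singleton]
    congr 1
    induction List.finRange r with
    | nil => rfl
    | cons j l ih =>
      by_cases h : i < j
      · rw [List.filter_cons_of_pos (by simpa using h), List.flatMap_cons, ← Multiset.coe_add, ih,
          List.map_cons, List.sum_cons, if_pos h, Multiset.nsmul_singleton,
          Multiset.coe_replicate]
      · rw [List.filter_cons_of_neg (by simpa using h), List.map_cons, List.sum_cons, ih, if_neg h,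
          zero_add]
  rw [Fintype.sum_sigma, Finset.sum_congr rfl fun p _ => h1 p, h2,
    ← Finset.sum_subtype (Finset.univ.filter fun p : Fin (r + 1) × Fin (r + 1) => p.1 < p.2)
      (by simp) (fun p => G p.1 p.2), Finset.sum_filter, Fintype.sum_prod_type,
    Finset.sum_eq_single i.castSucc, Fin.sum_univ_castSucc]
  · simp [G, Fin.castSucc_lt_last]
  · intro a _ ha
    simp [G, ha]
  · simp

/-- Exactly one sink index has source `i`; it accounts for the extra head vector, and the free
indices of source `i` give the rest. -/
theorem diffOpDirections_perm (hm : ∀ i j : Fin (r + 1), i < j → 0 < m i j) {n : ℕ}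
    {ε : Fin r ⊕ Fin n ≃ Index m} (hε : ∀ i, ε (Sum.inl i) = sinkIndex hm i) (i : Fin r) :
    (diffOpDirections m i).Perm (coords (root i.castSucc (Fin.last r)) ::
      ((List.ofFn fun k => rootDirection (ε (Sum.inr k)).1).filter fun c => c.1 = i).map
        Prod.snd) := by
  have h : ∀ j, rootDirection (sinkIndex hm j).1 = (j, coords (root j.castSucc (Fin.last r))) :=
    fun j => Prod.ext Fin.castPred_castSucc rfl
  rw [← Multiset.coe_eq_coe, coe_diffOpDirections, ← Equiv.sum_comp ε, Fintype.sum_sum_type,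
    ← Multiset.cons_coe, sum_filter_map, List.map_ofFn, List.sum_ofFn]
  simp only [hε, h, Finset.sum_ite_eq', Finset.mem_univ, if_true]
  rfl

/-- The dependent coordinates are the slacks `a_k - ∑ u_c w_c k`, so their nonnegativity is the
system of inequalities of the region. -/
theorem polytopeVolume_eq (hm : ∀ i j : Fin (r + 1), i < j → 0 < m i j) {n : ℕ}
    {ε : Fin r ⊕ Fin n ≃ Index m} (hε : ∀ i, ε (Sum.inl i) = sinkIndex hm i) (a : V r) :
    polytopeVolume m a =
      volume (orthantRegion (fun k => (rootDirection (ε (Sum.inr k)).1).2) (coords a)) := by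
  have hsingle : ∀ c : Index m, flowMap m (Pi.single c 1) = root c.1.1.1 c.1.1.2 := fun c => by
    rw [flowMap, Fintype.linearCombination_apply_single, one_smul]
  have hφ : ∀ i, flowMap m (Pi.single (ε (Sum.inl i)) 1) = rootBasis r i := fun i => by
    rw [hsingle, hε, rootBasis_apply]
    rfl
  have hb : ∀ a : V r, (rootBasis r).equivFun a = coords a := fun a => by
    rw [rootBasis, Module.Basis.equivFun_ofEquivFun]
    rfl
  rw [polytopeVolume, latticeMeasure, fiberVolume_eq_volume hφ]
  congr 1
  ext u
  have hsum : ∑ c : Index m, graphPoint (flowMap m) (rootBasis r) ε (a, u) c •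
      root c.1.1.1 c.1.1.2 = a := map_graphPoint hφ (a, u)
  simp only [polytope, orthantRegion, Set.mem_ofPred_eq, hsum, and_true, ε.surjective.forall,
    Sum.forall, graphPoint_inl, graphPoint_inr, hb, hsingle, sub_nonneg, rootDirection]
  exact and_comm

theorem coords_nonneg {a : V r} (ha : a ∈ closure (niceChamber r)) (k : Fin r) :
    0 ≤ coords a k := by
  have hc : IsClosed {a : V r | 0 ≤ coords a k} :=
    isClosed_le continuous_const ((continuous_apply _).comp continuous_subtype_val)
  exact closure_minimal (fun a ha => (ha k).le) hc ha

/-- Both polynomials agree on the open positive orthant, a product of infinite sets. -/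
theorem IsVolumePolynomial.unique {v w : MvPolynomial (Fin r) ℝ} (hv : IsVolumePolynomial m v)
    (hw : IsVolumePolynomial m w) : w = v := by
  refine MvPolynomial.funext_set (fun _ => Set.Ioi 0) (fun _ => Set.Ioi_infinite 0) fun x hx => ?_
  have hx' : coords ((coordsEquiv r).symm x) = x := (coordsEquiv r).apply_symm_apply x
  have ha : (coordsEquiv r).symm x ∈ closure (niceChamber r) := subset_closure fun i => by
    change 0 < coords ((coordsEquiv r).symm x) i
    rw [hx']
    exact hx i (Set.mem_univ i)
  rw [← hx', ← (hv _ ha).2, ← (hw _ ha).2]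

end VolumePolynomial

end FlowPolytope

end

theorem theorem3p1 (r : ℕ) (hr : 1 ≤ r) (m : Fin (r + 1) → Fin (r + 1) → ℕ)
    (hm : ∀ i j : Fin (r + 1), i < j → 0 < m i j) :
    ∃ v : MvPolynomial (Fin r) ℝ,
      FlowPolytope.IsVolumePolynomial m v ∧
      (∀ w : MvPolynomial (Fin r) ℝ, FlowPolytope.IsVolumePolynomial m w → w = v) ∧
      v.IsHomogeneous (FlowPolytope.total m - r) ∧
      ∀ i : Fin r, FlowPolytope.diffOp m i v = 0 := by
  open FlowPolytope in
  obtain ⟨n, ε, hε, hmono⟩ := exists_equiv_monotone_source hm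
  let e : Fin n → Fin r × (Fin r → ℝ) := fun k => rootDirection (ε (Sum.inr k)).1
  -- Counting along `ε` gives `M = r + n`, so the natural-number subtraction does not truncate.
  have hn : total m - r = n := by
    have h := Fintype.card_congr ε
    rw [card_index, Fintype.card_sum, Fintype.card_fin, Fintype.card_fin] at h
    omega
  have hv : IsVolumePolynomial m (iteratedAntideriv (List.ofFn e)) := fun a ha => by
    obtain ⟨h0, h⟩ := volume_orthantRegion e (fun c => rootDirection_source _)
      (fun c k => rootDirection_nonpos _) (fun b c hbc => rootDirection_nonneg _ (hmono hbc.le))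
      (coords_nonneg ha)
    rw [polytopeVolume_eq hm hε, h]
    exact ⟨ENNReal.ofReal_ne_top, ENNReal.toReal_ofReal h0⟩
  refine ⟨_, hv, fun w hw => hv.unique hw, ?_, fun i => ?_⟩
  · rw [hn]
    simpa using iteratedAntideriv_isHomogeneous (List.ofFn e)
  · rw [diffOp_eq, dirDerivProd_perm (diffOpDirections_perm hm hε i)]
    refine dirDerivProd_iteratedAntideriv_eq_zero ?_ ?_ ?_ i fun k hk => ?_
    · exact List.pairwise_ofFn.2 fun b c hbc => hmono hbc.le
    · simp only [List.forall_mem_ofFn_iff]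
      exact fun c => rootDirection_source _
    · simp only [List.forall_mem_ofFn_iff]
      exact fun c k => rootDirection_eq_zero _
    · simp [coords_root, hk, (Fin.castSucc_lt_last k).ne]
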